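/- Let $\mathcal A,\mathcal B$ be unital pro-$C^*$-algebras (complex unital $*$-algebras whose topology is complete, Hausdorff and defined by a family of $C^*$-seminorms), let $E$ be a full Hilbert $\mathcal A$-module, i.e. the closed linear span of $\{\langle x,y\rangle : x,y\in E\}$ is $\mathcal A$, and let $F$ be a Hilbert $\mathcal{BB}$-module, i.e. a Hilbert (right) $\mathcal B$-module with a non-degenerate $*$-homomorphism $\mathcal B\to\mathcal L_{\mathcal B}(F)$. Here $\mathcal L_{\mathcal B}(G,H)$ denotes the bounded adjointable $\mathcal B$-module operators $G\to H$. Let $\Phi,\Psi:E\to F$ be continuous completely positive maps: there are continuous completely positive linear maps $\phi,\psi:\mathcal A\to\mathcal B$ with $\langle\Phi(x),\Phi(y)\rangle=\phi(\langle x,y\rangle)$ and $\langle\Psi(x),\Psi(y)\rangle=\psi(\langle x,y\rangle)$ for all $x,y\in E$. Write $\Phi\sim\Psi$ if $\langle\Phi(x),\Phi(x)\rangle=\langle\Psi(x),\Psi(x)\rangle$ for all $x\in E$. Let $D$ be a Hilbert $\mathcal{BB}$-module and $\eta\in D$. A (minimal) Stinespring construction $(\pi_\Phi,K_\phi,K_\Phi,V_\phi,W_\Phi)$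 of $\Phi$ relative to $(D,\eta)$ consists of Hilbert $\mathcal B$-modules $K_\phi,K_\Phi$, a unital $*$-homomorphism $\pi_\phi:\mathcal A\to\mathcal L_{\mathcal B}(K_\phi)$, a map $\pi_\Phi:E\to\mathcal L_{\mathcal B}(K_\phi,K_\Phi)$ with $\pi_\Phi(x)^*\pi_\Phi(y)=\pi_\phi(\langle x,y\rangle)$, an operator $V_\phi\in\mathcal L_{\mathcal B}(D,K_\phi)$ and a co-isometry $W_\Phi\in\mathcal L_{\mathcal B}(F,K_\Phi)$ (that is, $W_\Phi W_\Phi^*=I$) such that, for all $a\in\mathcal A$, $d\in D$, $x\in E$, $$\phi(a)\,d=V_\phi^*\pi_\phi(a)V_\phi d,\qquad \Phi(x)=W_\Phi^*\pi_\Phi(x)V_\phi\eta,$$ and such that the linear spans of $\pi_\phi(\mathcal A)V_\phi D$ and of $\pi_\Phi(E)V_\phi D$ are dense in $K_\phi$ and $K_\Phi$ respectively. Let $(\pi_\Phi,K_\phi,K_\Phi,V_\phi,W_\Phi)$ and $(\pi_\Psi,K_\psi,K_\Psi,V_\psi,W_\Psi)$ be Stinespring constructions of $\Phi$ and $\Psi$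 relative to the same $(D,\eta)$. Then the following are equivalent: 1. $\Phi\sim\Psi$; 2. there are unitaries $U_1\in\mathcal L_{\mathcal B}(K_\phi,K_\psi)$, $U_2\in\mathcal L_{\mathcal B}(K_\Phi,K_\Psi)$ and a partial isometry $V\in\mathcal L_{\mathcal B}(F)$ with $VV^*=W_\Phi^*W_\Phi$, $V^*V=W_\Psi^*W_\Psi$ and $\Phi(x)=V\Psi(x)$ for all $x\in E$, such that (i) $V_\psi=U_1V_\phi$; (ii) $U_2\pi_\Phi(x)=\pi_\Psi(x)U_1$ for all $x\in E$; (iii) $W_\Phi=U_2^*W_\Psi V^*$; 3. the same as 2, without the requirement that $\Phi(x)=V\Psi(x)$ for all $x\in E$. -/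

import Mathlib

open Filter Topology MulOpposite

/-- A C*-seminorm on a complex *-algebra. -/
structure IsCStarSeminorm {A : Type*} [Ring A] [StarRing A] [Algebra ℂ A]
    (p : Seminorm ℂ A) : Prop where
  mul_le : ∀ x y : A, p (x * y) ≤ p x * p y
  star_eq : ∀ x : A, p (star x) = p x
  star_mul_self : ∀ x : A, p (star x * x) = p x ^ 2

/-- `A` is a (unital) pro-C*-algebra: its topology is complete, Hausdorff, and defined by a
family of C*-seminorms. -/
class ProCStarAlgebra (A : Type*) [Ring A] [StarRing A] [Algebra ℂ A] [StarModule ℂ A]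
    [UniformSpace A] : Prop extends IsUniformAddGroup A, CompleteSpace A, T2Space A where
  exists_seminorms : ∃ P : Set (Seminorm ℂ A), P.Nonempty ∧ (∀ p ∈ P, IsCStarSeminorm p) ∧
    WithSeminorms (fun p : P => (p : Seminorm ℂ A))

/-- The set `S(A)` of all continuous C*-seminorms on `A`. -/
def contCStarSeminorms (A : Type*) [Ring A] [StarRing A] [Algebra ℂ A] [TopologicalSpace A] :
    Set (Seminorm ℂ A) :=
  {p | Continuous p ∧ IsCStarSeminorm p}

/-- Positivity of an element of a *-ring: `a = b* b` for some `b`. -/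
def IsPosElem {R : Type*} [Mul R] [Star R] (a : R) : Prop :=
  ∃ b : R, a = star b * b

/-- Complete positivity of a linear map: all amplifications
`M_n(A) → M_n(B)`, `[a_ij] ↦ [φ(a_ij)]`, are positive. -/
def IsCompletelyPositive {A B : Type*} [Ring A] [StarRing A] [Algebra ℂ A]
    [Ring B] [StarRing B] [Algebra ℂ B] (φ : A →ₗ[ℂ] B) : Prop :=
  ∀ (n : ℕ) (M : Matrix (Fin n) (Fin n) A), IsPosElem ((star M * M).map φ)

/-- A Hilbert (right) module over a pro-C*-algebra `A`. The right action of `a` on `x` is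
`op a • x`. The topology of `E` is the group topology whose neighbourhoods of `0` are those of
the seminorms `x ↦ √(p ⟪x, x⟫)`, `p ∈ S(A)`, and `E` is complete for it. -/
class HilbertProModule (A E : Type*) [Ring A] [StarRing A] [Algebra ℂ A] [StarModule ℂ A]
    [UniformSpace A] [ProCStarAlgebra A] [AddCommGroup E] [Module ℂ E] [Module Aᵐᵒᵖ E]
    [UniformSpace E] extends Inner A E where
  inner_add_right : ∀ x y z : E, inner x (y + z) = inner x y + inner x z
  inner_smul_right : ∀ (c : ℂ) (x y : E), inner x (c • y) = c • inner x y
  inner_op_smul_right : ∀ (a : A) (x y : E), inner x (op a • y) = inner x y * a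
  star_inner : ∀ x y : E, star (inner x y) = inner y x
  inner_self_pos : ∀ x : E, IsPosElem (inner x x)
  inner_self_eq_zero : ∀ x : E, inner x x = 0 ↔ x = 0
  isUniformAddGroup : IsUniformAddGroup E
  nhds_zero : 𝓝 (0 : E) =
    ⨅ p ∈ contCStarSeminorms A, comap (fun x : E => Real.sqrt (p (inner x x))) (𝓝 0)
  complete : CompleteSpace E

section

variable {A B E F K : Type*}
  [Ring A] [StarRing A] [Algebra ℂ A] [StarModule ℂ A] [UniformSpace A] [ProCStarAlgebra A]
  [Ring B] [StarRing B] [Algebra ℂ B] [StarModule ℂ B] [UniformSpace B] [ProCStarAlgebra B]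

/-- `E` is full: the closed linear span of the inner products is all of `A`. -/
def IsFullModule (A E : Type*)
    [Ring A] [StarRing A] [Algebra ℂ A] [StarModule ℂ A] [UniformSpace A] [ProCStarAlgebra A]
    [AddCommGroup E] [Module ℂ E] [Module Aᵐᵒᵖ E] [UniformSpace E] [HilbertProModule A E] : Prop :=
  Dense (Submodule.span ℂ {a : A | ∃ x y : E, a = inner A x y} : Set A)

/-- The space `L_B(E, F)` of bounded adjointable `B`-module operators. -/
structure AdjOp (B E F : Type*)
    [Ring B] [StarRing B] [Algebra ℂ B] [StarModule ℂ B] [UniformSpace B] [ProCStarAlgebra B]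
    [AddCommGroup E] [Module ℂ E] [Module Bᵐᵒᵖ E] [UniformSpace E] [HilbertProModule B E]
    [AddCommGroup F] [Module ℂ F] [Module Bᵐᵒᵖ F] [UniformSpace F] [HilbertProModule B F]
    extends E →ₗ[ℂ] F where
  map_op_smul : ∀ (b : B) (x : E), toFun (op b • x) = op b • toFun x
  bounded : ∀ p ∈ contCStarSeminorms B, ∃ M : ℝ, 0 < M ∧ ∀ x : E,
    Real.sqrt (p (inner B (toFun x) (toFun x))) ≤ M * Real.sqrt (p (inner B x x))
  exists_adjoint : ∃ S : F → E, ∀ (x : E) (y : F), inner B (toFun x) y = inner B x (S y)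

variable
  [AddCommGroup E] [Module ℂ E] [Module Bᵐᵒᵖ E] [UniformSpace E] [HilbertProModule B E]
  [AddCommGroup F] [Module ℂ F] [Module Bᵐᵒᵖ F] [UniformSpace F] [HilbertProModule B F]

instance : CoeFun (AdjOp B E F) (fun _ => E → F) := ⟨fun T => T.toFun⟩

/-- The adjoint `T* : F → E` of `T ∈ L_B(E, F)`. -/
noncomputable def AdjOp.adj (T : AdjOp B E F) : F → E :=
  Classical.choose T.exists_adjoint

theorem AdjOp.inner_adj (T : AdjOp B E F) (x : E) (y : F) :
    inner B (T x) y = inner B x (T.adj y) :=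
  Classical.choose_spec T.exists_adjoint x y

/-- `U` is unitary: `U* U = 1` and `U U* = 1`. -/
def AdjOp.IsUnitary (U : AdjOp B E F) : Prop :=
  (∀ x, U.adj (U x) = x) ∧ (∀ y, U (U.adj y) = y)

/-- `V` is a partial isometry: `V V* V = V`. -/
def AdjOp.IsPartialIsometry (V : AdjOp B E F) : Prop :=
  ∀ x, V (V.adj (V x)) = V x

/-- `π : A → L_B(E)` is a *-morphism. -/
structure IsStarMorphism (π : A → AdjOp B E E) : Prop where
  map_add : ∀ (a b : A) (x : E), π (a + b) x = π a x + π b x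
  map_smul : ∀ (c : ℂ) (a : A) (x : E), π (c • a) x = c • π a x
  map_mul : ∀ (a b : A) (x : E), π (a * b) x = π a (π b x)
  map_star : ∀ (a : A) (x : E), π (star a) x = (π a).adj x

/-- A Hilbert `AB`-module: a Hilbert `B`-module with a non-degenerate left action
`τ : A → L_B(E)`. -/
class HilbertProBimodule (A B E : Type*)
    [Ring A] [StarRing A] [Algebra ℂ A] [StarModule ℂ A] [UniformSpace A] [ProCStarAlgebra A]
    [Ring B] [StarRing B] [Algebra ℂ B] [StarModule ℂ B] [UniformSpace B] [ProCStarAlgebra B]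
    [AddCommGroup E] [Module ℂ E] [Module Bᵐᵒᵖ E] [UniformSpace E] [HilbertProModule B E] where
  τ : A → AdjOp B E E
  isStarMorphism : IsStarMorphism τ
  nondegenerate : Dense (Submodule.span ℂ {y : E | ∃ (a : A) (x : E), y = τ a x} : Set E)

end

section

variable {A B E F D Kφ KΦ Kψ KΨ : Type*}
  [Ring A] [StarRing A] [Algebra ℂ A] [StarModule ℂ A] [UniformSpace A] [ProCStarAlgebra A]
  [Ring B] [StarRing B] [Algebra ℂ B] [StarModule ℂ B] [UniformSpace B] [ProCStarAlgebra B]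
  [AddCommGroup E] [Module ℂ E] [Module Aᵐᵒᵖ E] [UniformSpace E] [HilbertProModule A E]
  [AddCommGroup F] [Module ℂ F] [Module Bᵐᵒᵖ F] [UniformSpace F] [HilbertProModule B F]
  [AddCommGroup D] [Module ℂ D] [Module Bᵐᵒᵖ D] [UniformSpace D] [HilbertProModule B D]
  [HilbertProBimodule B B D]
  [AddCommGroup Kφ] [Module ℂ Kφ] [Module Bᵐᵒᵖ Kφ] [UniformSpace Kφ] [HilbertProModule B Kφ]
  [AddCommGroup KΦ] [Module ℂ KΦ] [Module Bᵐᵒᵖ KΦ] [UniformSpace KΦ] [HilbertProModule B KΦ]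
  [AddCommGroup Kψ] [Module ℂ Kψ] [Module Bᵐᵒᵖ Kψ] [UniformSpace Kψ] [HilbertProModule B Kψ]
  [AddCommGroup KΨ] [Module ℂ KΨ] [Module Bᵐᵒᵖ KΨ] [UniformSpace KΨ] [HilbertProModule B KΨ]

/-- `Φ ∈ CP(E, F)` with associated map `φ`: `Φ` is a `φ`-map, and `φ` is continuous and
completely positive. -/
structure IsCPMap (φ : A →ₗ[ℂ] B) (Φ : E → F) : Prop where
  continuous : Continuous φ
  completelyPositive : IsCompletelyPositive φ
  inner_map : ∀ x y : E, inner B (Φ x) (Φ y) = φ (inner A x y)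

/-- The relation `Φ ∼ Ψ`. -/
def CPEquiv (B : Type*) {E F : Type*} [Inner B F] (Φ Ψ : E → F) : Prop :=
  ∀ x : E, inner B (Φ x) (Φ x) = inner B (Ψ x) (Ψ x)

/-- A (minimal) Stinespring construction `(π_Φ, K_φ, K_Φ, V_φ, W_Φ)` of the `φ`-map `Φ`, relative
to the two-sided Hilbert `B`-module `D` and the vector `η ∈ D`
(written `1_B ⊗ ξ` when `D` comes from `B ⊗ X`). -/
structure StinespringConstruction (φ : A →ₗ[ℂ] B) (Φ : E → F) (η : D) (Kφ KΦ : Type*)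
    [AddCommGroup Kφ] [Module ℂ Kφ] [Module Bᵐᵒᵖ Kφ] [UniformSpace Kφ] [HilbertProModule B Kφ]
    [AddCommGroup KΦ] [Module ℂ KΦ] [Module Bᵐᵒᵖ KΦ] [UniformSpace KΦ]
    [HilbertProModule B KΦ] where
  /-- The representation `π_φ : A → L_B(K_φ)`. -/
  rep : A → AdjOp B Kφ Kφ
  /-- The map `π_Φ : E → L_B(K_φ, K_Φ)`. -/
  modRep : E → AdjOp B Kφ KΦ
  /-- The operator `V_φ : D → K_φ`. -/
  V : AdjOp B D Kφ
  /-- The operator `W_Φ : F → K_Φ`. -/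
  W : AdjOp B F KΦ
  rep_isStarMorphism : IsStarMorphism rep
  rep_one : ∀ k : Kφ, rep 1 k = k
  /-- `π_Φ` is a `π_φ`-morphism: `π_Φ(x)* π_Φ(y) = π_φ(⟨x, y⟩)`. -/
  modRep_inner : ∀ (x y : E) (k : Kφ), (modRep x).adj (modRep y k) = rep (inner A x y) k
  /-- `φ(a) I_D = V_φ* π_φ(a) V_φ`. -/
  map_eq : ∀ (a : A) (d : D), HilbertProBimodule.τ (B := B) (φ a) d = V.adj (rep a (V d))
  /-- `Φ(x) = W_Φ* π_Φ(x) V_φ η`. -/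
  modMap_eq : ∀ x : E, Φ x = W.adj (modRep x (V η))
  /-- `W_Φ` is a co-isometry. -/
  coisometry : ∀ k : KΦ, W (W.adj k) = k
  /-- `K_φ = [π_φ(A) V_φ D]`. -/
  minimal : Dense (Submodule.span ℂ {k : Kφ | ∃ (a : A) (d : D), k = rep a (V d)} : Set Kφ)
  /-- `K_Φ = [π_Φ(E) V_φ D]`. -/
  modMinimal :
    Dense (Submodule.span ℂ {k : KΦ | ∃ (x : E) (d : D), k = modRep x (V d)} : Set KΦ)

/-- `V ∈ L_B(F)` is a partial isometry with `V V* = W_Φ* W_Φ` and `V* V = W_Ψ* W_Ψ`. -/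
def IsLinkingIsometry (W₁ : AdjOp B F KΦ) (W₂ : AdjOp B F KΨ) (V : AdjOp B F F) : Prop :=
  V.IsPartialIsometry ∧ (∀ f, V (V.adj f) = W₁.adj (W₁ f)) ∧ (∀ f, V.adj (V f) = W₂.adj (W₂ f))

/-- The Stinespring constructions `S` of `Φ` and `T` of `Ψ` are related by `U₁`, `U₂`, `V`:
`V_ψ = U₁ V_φ`, `U₂ π_Φ(x) = π_Ψ(x) U₁` for all `x`, and `W_Φ = U₂* W_Ψ V*`. -/
structure StinespringRelated {φ ψ : A →ₗ[ℂ] B} {Φ Ψ : E → F} {η : D}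
    (S : StinespringConstruction φ Φ η Kφ KΦ) (T : StinespringConstruction ψ Ψ η Kψ KΨ)
    (U₁ : AdjOp B Kφ Kψ) (U₂ : AdjOp B KΦ KΨ) (V : AdjOp B F F) : Prop where
  V_eq : ∀ d : D, T.V d = U₁ (S.V d)
  modRep_eq : ∀ (x : E) (k : Kφ), U₂ (S.modRep x k) = T.modRep x (U₁ k)
  W_eq : ∀ f : F, S.W f = U₂.adj (T.W (V.adj f))

end

/-! A minimal Stinespring construction is determined up to unitaries by its Gram kernels: `⟪π_φ(a)V
d, π_φ(b)V e⟫ = ⟪d, φ(a* b) e⟫` and `⟪π_Φ(x)V d, π_Φ(y)V e⟫ = ⟪d, φ(⟪x, y⟫) e⟫` involve only `φ`. If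
`Φ ∼ Ψ`, then `φ` and `ψ` agree on every `⟪x, x⟫`, hence on every `⟪x, y⟫` by polarization, hence
everywhere by fullness and continuity (`CPEquiv.linearMap_eq`). Generating families with equal Gram
kernels are matched by a unitary (`AdjOp.exists_isUnitary_of_inner_eq`), which gives `U₁` and `U₂`;
the linking operator is `V = W_Φ* U₂* W_Ψ`.

Conversely, since `W_Φ` is a co-isometry, `⟪Φ x, Φ x⟫` is the square of `π_Φ(x) V_φ η`, which `U₂`
carries to `π_Ψ(x) V_ψ η`. -/

namespace HilbertProModule

/-! ### Algebra of the inner product. -/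

section Algebraic

variable {B E : Type*}
  [Ring B] [StarRing B] [Algebra ℂ B] [StarModule ℂ B] [UniformSpace B] [ProCStarAlgebra B]
  [AddCommGroup E] [Module ℂ E] [Module Bᵐᵒᵖ E] [UniformSpace E] [HilbertProModule B E]

theorem inner_add_left (x y z : E) : inner B (x + y) z = inner B x z + inner B y z := by
  rw [← star_inner, inner_add_right, star_add, star_inner, star_inner]

theorem inner_smul_left (c : ℂ) (x y : E) : inner B (c • x) y = star c • inner B x y := by
  rw [← star_inner, inner_smul_right, star_smul, star_inner]

variable (B) in
/-- The inner product as a linear map in its second variable. -/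
def innerRight (x : E) : E →ₗ[ℂ] B where
  toFun := inner B x
  map_add' := inner_add_right x
  map_smul' c := inner_smul_right c x

@[simp] theorem innerRight_apply (x y : E) : innerRight B x y = inner B x y := rfl

theorem inner_sub_right (x y z : E) : inner B x (y - z) = inner B x y - inner B x z :=
  map_sub (innerRight B x) y z

theorem inner_neg_right (x y : E) : inner B x (-y) = -inner B x y :=
  map_neg (innerRight B x) y

theorem inner_zero_right (x : E) : inner B x (0 : E) = 0 :=
  map_zero (innerRight B x)

theorem inner_neg_left (x y : E) : inner B (-x) y = -inner B x y := by
  rw [← star_inner, inner_neg_right, star_neg, star_inner]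

theorem inner_zero_left (y : E) : inner B (0 : E) y = 0 := by
  rw [← star_inner, inner_zero_right, star_zero]

/-- The polarization identity. -/
theorem four_smul_inner (x y : E) :
    (4 : ℂ) • inner B x y =
      inner B (x + y) (x + y) - inner B (x + -y) (x + -y)
        - Complex.I • inner B (x + Complex.I • y) (x + Complex.I • y)
        + Complex.I • inner B (x + -(Complex.I • y)) (x + -(Complex.I • y)) := by
  simp only [inner_add_left, inner_add_right, inner_neg_left, inner_neg_right, inner_smul_left,
    inner_smul_right, smul_add, smul_neg, smul_smul, Complex.star_def, Complex.conj_I, neg_smul,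
    neg_neg, Complex.I_mul_I, one_smul]
  module

end Algebraic

end HilbertProModule

/-! ### Convergence to zero and continuity of the inner product. -/

namespace ProCStarAlgebra

variable {B : Type*}
  [Ring B] [StarRing B] [Algebra ℂ B] [StarModule ℂ B] [UniformSpace B] [ProCStarAlgebra B]

/-- The defining seminorms are themselves continuous C*-seminorms, so testing on all of the latter
loses nothing. -/
theorem tendsto_zero_iff {α : Type*} {l : Filter α} {f : α → B} :
    Tendsto f l (𝓝 0) ↔ ∀ p ∈ contCStarSeminorms B, Tendsto (fun a => p (f a)) l (𝓝 0) := by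
  constructor
  · intro h p hp
    simpa [Function.comp_def] using (hp.1.tendsto 0).comp h
  · intro h
    obtain ⟨P, -, hP, hs⟩ := exists_seminorms (A := B)
    rw [hs.tendsto_nhds]
    intro p ε hε
    have := h p ⟨hs.continuous_seminorm p, hP p p.2⟩
    filter_upwards [this.eventually_lt_const hε] with a ha
    simpa using ha

theorem tendsto_const_smul_zero {α : Type*} {l : Filter α} {f : α → B} (c : ℂ)
    (h : Tendsto f l (𝓝 0)) : Tendsto (fun a => c • f a) l (𝓝 0) := by
  rw [tendsto_zero_iff] at h ⊢
  intro p hp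
  simpa [map_smul_eq_mul] using (h p hp).const_mul ‖c‖

end ProCStarAlgebra

namespace HilbertProModule

section Topological

variable {B E : Type*}
  [Ring B] [StarRing B] [Algebra ℂ B] [StarModule ℂ B] [UniformSpace B] [ProCStarAlgebra B]
  [AddCommGroup E] [Module ℂ E] [Module Bᵐᵒᵖ E] [UniformSpace E] [HilbertProModule B E]

variable (B) in
theorem tendsto_zero_iff_sqrt {α : Type*} {l : Filter α} {f : α → E} :
    Tendsto f l (𝓝 0) ↔ ∀ p ∈ contCStarSeminorms B,
      Tendsto (fun a => Real.sqrt (p (inner B (f a) (f a)))) l (𝓝 0) := by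
  rw [nhds_zero (A := B)]
  simp only [tendsto_iInf, tendsto_comap_iff, Function.comp_def]

-- Removing the square root reduces convergence in the module to convergence in `B`, so it transfers
-- between modules whose inner products agree.
variable (B) in
theorem tendsto_zero_iff_inner_self {α : Type*} {l : Filter α} {f : α → E} :
    Tendsto f l (𝓝 0) ↔ Tendsto (fun a => inner B (f a) (f a)) l (𝓝 0) := by
  rw [tendsto_zero_iff_sqrt B, ProCStarAlgebra.tendsto_zero_iff]
  refine forall₂_congr fun p _ => ⟨fun h => ?_, fun h => ?_⟩
  · simpa [Real.sq_sqrt (apply_nonneg p _)] using h.pow 2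
  · simpa using h.sqrt

theorem tendsto_const_smul_zero (B : Type*) {E α : Type*}
    [Ring B] [StarRing B] [Algebra ℂ B] [StarModule ℂ B] [UniformSpace B] [ProCStarAlgebra B]
    [AddCommGroup E] [Module ℂ E] [Module Bᵐᵒᵖ E] [UniformSpace E] [HilbertProModule B E]
    {l : Filter α} {f : α → E} (c : ℂ)
    (h : Tendsto f l (𝓝 0)) : Tendsto (fun a => c • f a) l (𝓝 0) := by
  rw [tendsto_zero_iff_inner_self B] at h ⊢
  simp only [inner_smul_left, inner_smul_right]
  exact ProCStarAlgebra.tendsto_const_smul_zero _ (ProCStarAlgebra.tendsto_const_smul_zero _ h)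

/-- Polarization replaces the Cauchy–Schwarz inequality: each of the four squares tends to zero. -/
theorem tendsto_inner_zero {α : Type*} {l : Filter α} {f g : α → E}
    (hf : Tendsto f l (𝓝 0)) (hg : Tendsto g l (𝓝 0)) :
    Tendsto (fun a => inner B (f a) (g a)) l (𝓝 0) := by
  have := isUniformAddGroup (A := B) (E := E)
  have key : ∀ {h : α → E}, Tendsto h l (𝓝 0) →
      Tendsto (fun a => inner B (f a + h a) (f a + h a)) l (𝓝 0) := fun hh =>
    (tendsto_zero_iff_inner_self B).1 (by simpa using hf.add hh)
  have hIg := tendsto_const_smul_zero B Complex.I hg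
  have hneg : ∀ {h : α → E}, Tendsto h l (𝓝 0) → Tendsto (fun a => -h a) l (𝓝 0) :=
    fun hh => by simpa using hh.neg
  have h4 := (((key hg).sub (key (hneg hg))).sub
    (ProCStarAlgebra.tendsto_const_smul_zero Complex.I (key hIg))).add
    (ProCStarAlgebra.tendsto_const_smul_zero Complex.I (key (hneg hIg)))
  simp only [← four_smul_inner, sub_zero, add_zero] at h4
  simpa [smul_smul] using ProCStarAlgebra.tendsto_const_smul_zero (4 : ℂ)⁻¹ h4

theorem tendsto_smul_zero (B : Type*) {E : Type*}
    [Ring B] [StarRing B] [Algebra ℂ B] [StarModule ℂ B] [UniformSpace B] [ProCStarAlgebra B]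
    [AddCommGroup E] [Module ℂ E] [Module Bᵐᵒᵖ E] [UniformSpace E] [HilbertProModule B E] (x : E) :
    Tendsto (fun t : ℂ => t • x) (𝓝 0) (𝓝 0) := by
  rw [tendsto_zero_iff_inner_self B, ProCStarAlgebra.tendsto_zero_iff]
  intro p _
  simp only [inner_smul_left, inner_smul_right, map_smul_eq_mul, norm_star]
  have : Continuous fun t : ℂ => ‖t‖ * (‖t‖ * p (inner B x x)) := by fun_prop
  simpa using this.tendsto 0

/-- Joint continuity at the origin gives continuity in one variable by rescaling: `⟪x, y⟫ = ⟪t x,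
t⁻¹ y⟫`, with `t ≠ 0` fixed so small that `t x` is near zero, while `t⁻¹ y` tends to zero with `y`.
-/
theorem continuous_inner_right (x : E) : Continuous fun y : E => inner B x y := by
  have := isUniformAddGroup (A := B) (E := E)
  refine continuous_of_continuousAt_zero (innerRight B x).toAddMonoidHom ?_
  change Tendsto (fun y => inner B x y) (𝓝 0) (𝓝 (inner B x 0))
  rw [inner_zero_right, ProCStarAlgebra.tendsto_zero_iff]
  intro p hp
  have h0 : Tendsto (fun z : E × E => p (inner B z.1 z.2)) (𝓝 0 ×ˢ 𝓝 0) (𝓝 0) :=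
    ProCStarAlgebra.tendsto_zero_iff.1 (tendsto_inner_zero tendsto_fst tendsto_snd) p hp
  rw [Metric.tendsto_nhds]
  intro ε hε
  obtain ⟨U, hU, U', hU', hUU⟩ :=
    mem_prod_iff.1 (h0.eventually (Metric.ball_mem_nhds 0 hε))
  have ht : ∀ᶠ t : ℂ in 𝓝[≠] 0, t • x ∈ U :=
    ((tendsto_smul_zero B x).mono_left nhdsWithin_le_nhds).eventually hU
  obtain ⟨t, htU, ht0⟩ := (ht.and self_mem_nhdsWithin).exists
  filter_upwards [tendsto_const_smul_zero B t⁻¹ tendsto_id hU'] with y hy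
  have hm : (t • x, t⁻¹ • y) ∈ U ×ˢ U' := ⟨htU, hy⟩
  have := hUU hm
  have ht1 : ‖t‖ ≠ 0 := norm_ne_zero_iff.2 ht0
  simpa [inner_smul_left, inner_smul_right, map_smul_eq_mul, ht1] using this

theorem continuous_inner_left (y : E) : Continuous fun x : E => inner B x y := by
  have := isUniformAddGroup (A := B) (E := E)
  have hz : Tendsto (fun x : E => inner B x y) (𝓝 0) (𝓝 0) := by
    rw [ProCStarAlgebra.tendsto_zero_iff]
    intro p hp
    have h := (continuous_inner_right (B := B) y).tendsto 0
    rw [inner_zero_right] at h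
    refine (ProCStarAlgebra.tendsto_zero_iff.1 h p hp).congr fun x => ?_
    rw [← star_inner, hp.2.star_eq]
  refine continuous_of_continuousAt_zero
    (AddMonoidHom.mk' (fun x : E => inner B x y) fun a b => inner_add_left a b y) ?_
  change Tendsto (fun x => inner B x y) (𝓝 0) (𝓝 (inner B 0 y))
  rwa [inner_zero_left]

/-- A vector is determined by its inner products with a family with dense linear span. -/
theorem ext_of_dense_span {s : Set E} (hs : Dense (Submodule.span ℂ s : Set E)) {z w : E}
    (h : ∀ g ∈ s, inner B g z = inner B g w) : z = w := by
  have hspan : ∀ g ∈ Submodule.span ℂ s, inner B g (z - w) = 0 := by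
    intro g hg
    induction hg using Submodule.span_induction with
    | mem g hg => rw [inner_sub_right, h g hg, sub_self]
    | zero => exact inner_zero_left _
    | add a b _ _ ha hb => rw [inner_add_left, ha, hb, add_zero]
    | smul c a _ ha => rw [inner_smul_left, ha, smul_zero]
  have hall := (continuous_inner_left (B := B) (z - w)).ext_on hs continuous_const hspan
  exact sub_eq_zero.1 ((inner_self_eq_zero (A := B) _).1 (congrFun hall (z - w)))

theorem ext_inner_left {z w : E} (h : ∀ g : E, inner B g z = inner B g w) : z = w :=
  ext_of_dense_span (B := B) (s := Set.univ) (by simp) fun g _ => h g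

end Topological

/-! ### Transport of vectors between modules with equal Gram kernels. -/

section Extension

variable {B K K' ι : Type*}
  [Ring B] [StarRing B] [Algebra ℂ B] [StarModule ℂ B] [UniformSpace B] [ProCStarAlgebra B]
  [AddCommGroup K] [Module ℂ K] [Module Bᵐᵒᵖ K] [UniformSpace K] [HilbertProModule B K]
  [AddCommGroup K'] [Module ℂ K'] [Module Bᵐᵒᵖ K'] [UniformSpace K'] [HilbertProModule B K']

theorem inner_linearCombination_left_congr {g : ι → K} {g' : ι → K'} {z : K} {z' : K'}
    (h : ∀ i, inner B (g i) z = inner B (g' i) z') (f : ι →₀ ℂ) :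
    inner B (Finsupp.linearCombination ℂ g f) z =
      inner B (Finsupp.linearCombination ℂ g' f) z' := by
  induction f using Finsupp.induction_linear with
  | zero => simp [inner_zero_left]
  | add f₁ f₂ h₁ h₂ => rw [map_add, map_add, inner_add_left, inner_add_left, h₁, h₂]
  | single i c => simp [inner_smul_left, h]

theorem inner_linearCombination_congr {g : ι → K} {g' : ι → K'}
    (h : ∀ i j, inner B (g i) (g j) = inner B (g' i) (g' j)) (f₁ f₂ : ι →₀ ℂ) :
    inner B (Finsupp.linearCombination ℂ g f₁) (Finsupp.linearCombination ℂ g f₂) =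
      inner B (Finsupp.linearCombination ℂ g' f₁) (Finsupp.linearCombination ℂ g' f₂) := by
  refine inner_linearCombination_left_congr (fun i => ?_) f₁
  rw [← star_inner, ← star_inner (Finsupp.linearCombination ℂ g' f₂)]
  congr 1
  exact inner_linearCombination_left_congr (fun j => h j i) f₂

/-- Each vector of `K` has a counterpart in `K'` when `K` and `K'` are generated by families with
the same inner products. -/
theorem exists_corresponding {g : ι → K} {g' : ι → K'}
    (hg : Dense (Submodule.span ℂ (Set.range g) : Set K))
    (h : ∀ i j, inner B (g i) (g j) = inner B (g' i) (g' j)) (k : K) :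
    ∃ k' : K', ∀ (z : K) (z' : K'), (∀ i, inner B (g i) z = inner B (g' i) z') →
      inner B k z = inner B k' z' := by
  have := isUniformAddGroup (A := B) (E := K)
  have := isUniformAddGroup (A := B) (E := K')
  have := complete (A := B) (E := K')
  set G := Finsupp.linearCombination ℂ g
  set G' := Finsupp.linearCombination ℂ g'
  -- Coefficient vectors whose combinations approach `k`; equality of the Gram kernels makes the
  -- image of this filter under `G'` Cauchy, and its limit is the counterpart.
  let L := comap G (𝓝 k)
  have hG : Tendsto G L (𝓝 k) := tendsto_comap
  have hL : L.NeBot := by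
    rw [← Finsupp.range_linearCombination] at hg
    exact comap_neBot_iff_frequently.2 (mem_closure_iff_frequently.1 (hg k))
  have hsub : Tendsto (fun q : (ι →₀ ℂ) × (ι →₀ ℂ) => G (q.2 - q.1)) (L ×ˢ L) (𝓝 0) := by
    simpa using (hG.comp tendsto_snd).sub (hG.comp tendsto_fst)
  have hsub' : Tendsto (fun q : (ι →₀ ℂ) × (ι →₀ ℂ) => G' (q.2 - q.1)) (L ×ˢ L) (𝓝 0) := by
    rw [tendsto_zero_iff_inner_self B] at hsub ⊢
    exact hsub.congr fun q => inner_linearCombination_congr h _ _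
  have hc : Cauchy (map G' L) := by
    rw [cauchy_map_iff]
    refine ⟨hL, ?_⟩
    rw [uniformity_eq_comap_nhds_zero, tendsto_comap_iff]
    simpa [Function.comp_def] using hsub'
  obtain ⟨k', hk'⟩ := CompleteSpace.complete hc
  refine ⟨k', fun z z' hz => tendsto_nhds_unique
    (((continuous_inner_left (B := B) z).tendsto k).comp hG) ?_⟩
  refine (((continuous_inner_left (B := B) z').tendsto k').comp hk').congr fun f => ?_
  exact (inner_linearCombination_left_congr hz f).symm

end Extension

end HilbertProModule

/-! ### Construction of adjointable operators and unitaries. -/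

open HilbertProModule in
/-- Maps that are adjoint to one another and inverse on one side are isometric, hence bounded
adjointable module operators. -/
def AdjOp.ofIsometry {B K K' : Type*}
    [Ring B] [StarRing B] [Algebra ℂ B] [StarModule ℂ B] [UniformSpace B] [ProCStarAlgebra B]
    [AddCommGroup K] [Module ℂ K] [Module Bᵐᵒᵖ K] [UniformSpace K] [HilbertProModule B K]
    [AddCommGroup K'] [Module ℂ K'] [Module Bᵐᵒᵖ K'] [UniformSpace K'] [HilbertProModule B K']
    (u : K → K') (v : K' → K) (huv : ∀ x y, inner B (u x) y = inner B x (v y))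
    (hvu : ∀ x, v (u x) = x) : AdjOp B K K' :=
  have hvu' (x : K) (y : K') : inner B y (u x) = inner B (v y) x := by
    rw [← star_inner, huv, star_inner]
  { toFun := u
    map_add' x y := ext_inner_left (B := B) fun g => by
      rw [HilbertProModule.inner_add_right, hvu', hvu', hvu', HilbertProModule.inner_add_right]
    map_smul' c x := ext_inner_left (B := B) fun g => by
      rw [RingHom.id_apply, HilbertProModule.inner_smul_right, hvu', hvu',
        HilbertProModule.inner_smul_right]
    map_op_smul b x := ext_inner_left (B := B) fun g => by
      rw [inner_op_smul_right, hvu', hvu', inner_op_smul_right]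
    bounded p _ := ⟨1, one_pos, fun x => by
      rw [huv, hvu, one_mul]⟩
    exists_adjoint := ⟨v, huv⟩ }

namespace AdjOp

open HilbertProModule

variable {B E F G : Type*}
  [Ring B] [StarRing B] [Algebra ℂ B] [StarModule ℂ B] [UniformSpace B] [ProCStarAlgebra B]
  [AddCommGroup E] [Module ℂ E] [Module Bᵐᵒᵖ E] [UniformSpace E] [HilbertProModule B E]
  [AddCommGroup F] [Module ℂ F] [Module Bᵐᵒᵖ F] [UniformSpace F] [HilbertProModule B F]
  [AddCommGroup G] [Module ℂ G] [Module Bᵐᵒᵖ G] [UniformSpace G] [HilbertProModule B G]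

theorem inner_adj_left (T : AdjOp B E F) (y : F) (x : E) :
    inner B (T.adj y) x = inner B y (T x) := by
  rw [← star_inner, ← inner_adj, star_inner]

/-- Adjoints are unique, so the one obtained by choice can be computed. -/
theorem adj_eq_of_inner (T : AdjOp B E F) {v : F → E}
    (h : ∀ x y, inner B (T x) y = inner B x (v y)) (y : F) : T.adj y = v y :=
  ext_inner_left (B := B) fun g => by rw [← inner_adj, h]

theorem IsUnitary.inner_map_map {U : AdjOp B E F} (hU : U.IsUnitary) (x y : E) :
    inner B (U x) (U y) = inner B x y := by
  rw [inner_adj, hU.1]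

/-- Families with the same inner products and dense spans are intertwined by a unitary. -/
theorem exists_isUnitary_of_inner_eq {ι : Type*} {g : ι → E} {g' : ι → F}
    (hg : Dense (Submodule.span ℂ (Set.range g) : Set E))
    (hg' : Dense (Submodule.span ℂ (Set.range g') : Set F))
    (h : ∀ i j, inner B (g i) (g j) = inner B (g' i) (g' j)) :
    ∃ U : AdjOp B E F, U.IsUnitary ∧ ∀ i, U (g i) = g' i := by
  choose u hu using exists_corresponding hg h
  choose v hv using exists_corresponding hg' fun i j => (h i j).symm
  have hu' (i : ι) (x : E) : inner B (g' i) (u x) = inner B (g i) x := by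
    rw [← star_inner, ← hu x (g i) (g' i) fun j => h j i, star_inner]
  have hv' (i : ι) (y : F) : inner B (g i) (v y) = inner B (g' i) y := by
    rw [← star_inner, ← hv y (g' i) (g i) fun j => (h j i).symm, star_inner]
  -- The pair `(v y, y)` has matching inner products with the generators, so `u` and `v` are
  -- mutually adjoint; linearity and boundedness then follow from `ofIsometry`.
  have huv (x : E) (y : F) : inner B (u x) y = inner B x (v y) :=
    (hu x (v y) y fun i => hv' i y).symm
  have hvu (x : E) : v (u x) = x :=
    ext_of_dense_span (B := B) hg <| by rintro _ ⟨i, rfl⟩; rw [hv', hu']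
  have huv' (y : F) : u (v y) = y :=
    ext_of_dense_span (B := B) hg' <| by rintro _ ⟨i, rfl⟩; rw [hu', hv']
  have hadj (y : F) : (ofIsometry u v huv hvu).adj y = v y :=
    adj_eq_of_inner _ (fun x y => huv x y) y
  refine ⟨ofIsometry u v huv hvu, ⟨fun x => ?_, fun y => ?_⟩, fun i => ?_⟩
  · rw [hadj]
    exact hvu x
  · rw [hadj]
    exact huv' y
  · refine ext_of_dense_span (B := B) hg' ?_
    rintro _ ⟨j, rfl⟩
    exact (hu' j (g i)).trans (h j i)

/-- The adjoint of a co-isometry, as an adjointable operator. -/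
noncomputable def coisometryAdj (T : AdjOp B E F) (hT : ∀ y, T (T.adj y) = y) : AdjOp B F E :=
  ofIsometry T.adj T T.inner_adj_left hT

/-- The composition of adjointable operators. -/
noncomputable def comp (T : AdjOp B F G) (S : AdjOp B E F) : AdjOp B E G where
  toLinearMap := T.toLinearMap.comp S.toLinearMap
  map_op_smul b x := by
    change T (S (op b • x)) = op b • T (S x)
    rw [S.map_op_smul, T.map_op_smul]
  bounded p hp := by
    obtain ⟨M, hM, hT⟩ := T.bounded p hp
    obtain ⟨N, hN, hS⟩ := S.bounded p hp
    exact ⟨M * N, mul_pos hM hN, fun x => (hT (S x)).trans <| by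
      rw [mul_assoc]; exact mul_le_mul_of_nonneg_left (hS x) hM.le⟩
  exists_adjoint := ⟨fun y => S.adj (T.adj y), fun x y => by
    rw [← inner_adj, ← inner_adj]; rfl⟩

end AdjOp

theorem IsStarMorphism.inner_left {A B K : Type*}
    [Ring A] [StarRing A] [Algebra ℂ A]
    [Ring B] [StarRing B] [Algebra ℂ B] [StarModule ℂ B] [UniformSpace B] [ProCStarAlgebra B]
    [AddCommGroup K] [Module ℂ K] [Module Bᵐᵒᵖ K] [UniformSpace K] [HilbertProModule B K]
    {π : A → AdjOp B K K} (hπ : IsStarMorphism π) (a : A)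
    (x y : K) : inner B (π a x) y = inner B x (π (star a) y) := by
  rw [AdjOp.inner_adj, hπ.map_star]

/-! ### Uniqueness of Stinespring constructions and the equivalence. -/

section

open HilbertProModule

variable {A B E F D Kφ KΦ Kψ KΨ : Type*}
  [Ring A] [StarRing A] [Algebra ℂ A] [StarModule ℂ A] [UniformSpace A] [ProCStarAlgebra A]
  [Ring B] [StarRing B] [Algebra ℂ B] [StarModule ℂ B] [UniformSpace B] [ProCStarAlgebra B]
  [AddCommGroup E] [Module ℂ E] [Module Aᵐᵒᵖ E] [UniformSpace E] [HilbertProModule A E]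
  [AddCommGroup F] [Module ℂ F] [Module Bᵐᵒᵖ F] [UniformSpace F] [HilbertProModule B F]
  [AddCommGroup D] [Module ℂ D] [Module Bᵐᵒᵖ D] [UniformSpace D] [HilbertProModule B D]
  [HilbertProBimodule B B D]
  [AddCommGroup Kφ] [Module ℂ Kφ] [Module Bᵐᵒᵖ Kφ] [UniformSpace Kφ] [HilbertProModule B Kφ]
  [AddCommGroup KΦ] [Module ℂ KΦ] [Module Bᵐᵒᵖ KΦ] [UniformSpace KΦ] [HilbertProModule B KΦ]
  [AddCommGroup Kψ] [Module ℂ Kψ] [Module Bᵐᵒᵖ Kψ] [UniformSpace Kψ] [HilbertProModule B Kψ]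
  [AddCommGroup KΨ] [Module ℂ KΨ] [Module Bᵐᵒᵖ KΨ] [UniformSpace KΨ] [HilbertProModule B KΨ]

/-- Equivalent completely positive maps on a full module have the same associated map. -/
theorem CPEquiv.linearMap_eq (hE : IsFullModule A E) {φ ψ : A →ₗ[ℂ] B} {Φ Ψ : E → F}
    (hΦ : IsCPMap φ Φ) (hΨ : IsCPMap ψ Ψ) (h : CPEquiv B Φ Ψ) : φ = ψ := by
  have hself (x : E) : φ (inner A x x) = ψ (inner A x x) := by
    rw [← hΦ.inner_map, ← hΨ.inner_map, h x]
  have hinner (x y : E) : φ (inner A x y) = ψ (inner A x y) := by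
    have h4 : φ ((4 : ℂ) • inner A x y) = ψ ((4 : ℂ) • inner A x y) := by
      rw [four_smul_inner]
      simp only [map_add, map_sub, map_smul, hself]
    rw [map_smul, map_smul] at h4
    simpa using congrArg (fun b => (4 : ℂ)⁻¹ • b) h4
  have hle : Submodule.span ℂ {a : A | ∃ x y : E, a = inner A x y} ≤ LinearMap.eqLocus φ ψ :=
    Submodule.span_le.2 (by rintro _ ⟨x, y, rfl⟩; exact hinner x y)
  exact DFunLike.coe_injective
    (hΦ.continuous.ext_on hE hΨ.continuous fun a ha => hle ha)

namespace StinespringConstruction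

variable {φ ψ : A →ₗ[ℂ] B} {Φ Ψ : E → F} {η : D}

theorem inner_modRep (S : StinespringConstruction φ Φ η Kφ KΦ) (x y : E) (k l : Kφ) :
    inner B (S.modRep x k) (S.modRep y l) = inner B k (S.rep (inner A x y) l) := by
  rw [AdjOp.inner_adj, S.modRep_inner]

theorem inner_V_rep_V (S : StinespringConstruction φ Φ η Kφ KΦ) (a : A) (d e : D) :
    inner B (S.V d) (S.rep a (S.V e)) =
      inner B d (HilbertProBimodule.τ (B := B) (φ a) e) := by
  rw [AdjOp.inner_adj, S.map_eq]

theorem dense_span_range_rep (S : StinespringConstruction φ Φ η Kφ KΦ) :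
    Dense (Submodule.span ℂ (Set.range fun q : A × D => S.rep q.1 (S.V q.2)) : Set Kφ) := by
  convert S.minimal using 4
  ext k
  simp [eq_comm]

theorem dense_span_range_modRep (S : StinespringConstruction φ Φ η Kφ KΦ) :
    Dense (Submodule.span ℂ (Set.range fun q : E × D => S.modRep q.1 (S.V q.2)) : Set KΦ) := by
  convert S.modMinimal using 4
  ext k
  simp [eq_comm]

/-- Two Stinespring constructions with the same associated map are unitarily equivalent. -/
theorem exists_unitaries (S : StinespringConstruction φ Φ η Kφ KΦ)
    (T : StinespringConstruction φ Ψ η Kψ KΨ) :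
    ∃ (U₁ : AdjOp B Kφ Kψ) (U₂ : AdjOp B KΦ KΨ), U₁.IsUnitary ∧ U₂.IsUnitary ∧
      (∀ d : D, T.V d = U₁ (S.V d)) ∧
      ∀ (x : E) (k : Kφ), U₂ (S.modRep x k) = T.modRep x (U₁ k) := by
  obtain ⟨U₁, hU₁, h₁⟩ := AdjOp.exists_isUnitary_of_inner_eq (B := B)
    S.dense_span_range_rep T.dense_span_range_rep (by
      rintro ⟨a, d⟩ ⟨b, e⟩
      simp only
      rw [S.rep_isStarMorphism.inner_left, T.rep_isStarMorphism.inner_left,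
        ← S.rep_isStarMorphism.map_mul, ← T.rep_isStarMorphism.map_mul, S.inner_V_rep_V,
        T.inner_V_rep_V])
  obtain ⟨U₂, hU₂, h₂⟩ := AdjOp.exists_isUnitary_of_inner_eq (B := B)
    S.dense_span_range_modRep T.dense_span_range_modRep (by
      rintro ⟨x, d⟩ ⟨y, e⟩
      simp only
      rw [S.inner_modRep, T.inner_modRep, S.inner_V_rep_V, T.inner_V_rep_V])
  have h₁' (a : A) (d : D) : U₁ (S.rep a (S.V d)) = T.rep a (T.V d) := h₁ (a, d)
  have h₂' (x : E) (d : D) : U₂ (S.modRep x (S.V d)) = T.modRep x (T.V d) := h₂ (x, d)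
  have hV (d : D) : T.V d = U₁ (S.V d) := by
    rw [← T.rep_one (T.V d), ← h₁', S.rep_one]
  -- `U₁` intertwines the representations: against a generator `π(b)V d`, moving `π(a)` across turns
  -- `b` into `a* b`, again a generator.
  have hrep (a : A) (k : Kφ) : U₁ (S.rep a k) = T.rep a (U₁ k) := by
    refine ext_of_dense_span (B := B) T.dense_span_range_rep ?_
    rintro _ ⟨⟨b, d⟩, rfl⟩
    have hs : inner B (T.rep b (T.V d)) (T.rep a (U₁ k)) =
        inner B (T.rep (star a * b) (T.V d)) (U₁ k) := by
      rw [T.rep_isStarMorphism.map_mul, T.rep_isStarMorphism.inner_left (star a), star_star]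
    simp only
    rw [hs, ← h₁', ← h₁', hU₁.inner_map_map, hU₁.inner_map_map, S.rep_isStarMorphism.map_mul,
      S.rep_isStarMorphism.inner_left (star a), star_star]
  -- The relation known on the vectors `V d` extends to all `k` by testing against the generators of
  -- the target, where `hrep` applies.
  refine ⟨U₁, U₂, hU₁, hU₂, hV, fun x k => ?_⟩
  refine ext_of_dense_span (B := B) T.dense_span_range_modRep ?_
  rintro _ ⟨⟨y, d⟩, rfl⟩
  simp only
  rw [T.inner_modRep, ← hrep, hV, hU₁.inner_map_map, ← S.inner_modRep, ← hV, ← h₂',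
    hU₂.inner_map_map]

theorem inner_self_map (S : StinespringConstruction φ Φ η Kφ KΦ) (x : E) :
    inner B (Φ x) (Φ x) = inner B (S.modRep x (S.V η)) (S.modRep x (S.V η)) := by
  rw [S.modMap_eq, AdjOp.inner_adj_left, S.coisometry]

end StinespringConstruction

theorem StinespringRelated.cpEquiv {φ ψ : A →ₗ[ℂ] B} {Φ Ψ : E → F} {η : D}
    {S : StinespringConstruction φ Φ η Kφ KΦ} {T : StinespringConstruction ψ Ψ η Kψ KΨ}
    {U₁ : AdjOp B Kφ Kψ} {U₂ : AdjOp B KΦ KΨ} {V : AdjOp B F F} (hU₂ : U₂.IsUnitary)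
    (h : StinespringRelated S T U₁ U₂ V) : CPEquiv B Φ Ψ := fun x => by
  rw [S.inner_self_map, T.inner_self_map, h.V_eq, ← h.modRep_eq, hU₂.inner_map_map]

/-- The operator `W₁* U* W₂` linking two co-isometries through a unitary. -/
theorem AdjOp.exists_linking {W₁ : AdjOp B F KΦ} {W₂ : AdjOp B F KΨ} {U : AdjOp B KΦ KΨ}
    (h₁ : ∀ k, W₁ (W₁.adj k) = k) (h₂ : ∀ k, W₂ (W₂.adj k) = k) (hU : U.IsUnitary) :
    ∃ V : AdjOp B F F, (∀ f, V f = W₁.adj (U.adj (W₂ f))) ∧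
      (∀ f, V.adj f = W₂.adj (U (W₁ f))) ∧ IsLinkingIsometry W₁ W₂ V := by
  -- A unitary is a co-isometry, so its adjoint is an operator by the same construction.
  let V : AdjOp B F F := (W₁.coisometryAdj h₁).comp ((U.coisometryAdj hU.2).comp W₂)
  have hV (f : F) : V f = W₁.adj (U.adj (W₂ f)) := rfl
  have hadj (f : F) : V.adj f = W₂.adj (U (W₁ f)) := by
    refine V.adj_eq_of_inner (v := fun f => W₂.adj (U (W₁ f))) (fun x y => ?_) f
    rw [hV, AdjOp.inner_adj_left, AdjOp.inner_adj_left, AdjOp.inner_adj]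
  refine ⟨V, hV, hadj, fun f => ?_, fun f => ?_, fun f => ?_⟩
  · rw [hadj, hV, hV, h₂, hU.1, h₁]
  · rw [hadj, hV, h₂, hU.1]
  · rw [hadj, hV, h₁, hU.2]

end

theorem mainTheorem5 {A B E F D Kφ KΦ Kψ KΨ : Type*}
    [Ring A] [StarRing A] [Algebra ℂ A] [StarModule ℂ A] [UniformSpace A] [ProCStarAlgebra A]
    [Ring B] [StarRing B] [Algebra ℂ B] [StarModule ℂ B] [UniformSpace B] [ProCStarAlgebra B]
    [AddCommGroup E] [Module ℂ E] [Module Aᵐᵒᵖ E] [UniformSpace E] [HilbertProModule A E]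
    [AddCommGroup F] [Module ℂ F] [Module Bᵐᵒᵖ F] [UniformSpace F] [HilbertProModule B F]
    [HilbertProBimodule B B F]
    [AddCommGroup D] [Module ℂ D] [Module Bᵐᵒᵖ D] [UniformSpace D] [HilbertProModule B D]
    [HilbertProBimodule B B D]
    [AddCommGroup Kφ] [Module ℂ Kφ] [Module Bᵐᵒᵖ Kφ] [UniformSpace Kφ] [HilbertProModule B Kφ]
    [AddCommGroup KΦ] [Module ℂ KΦ] [Module Bᵐᵒᵖ KΦ] [UniformSpace KΦ] [HilbertProModule B KΦ]
    [AddCommGroup Kψ] [Module ℂ Kψ] [Module Bᵐᵒᵖ Kψ] [UniformSpace Kψ] [HilbertProModule B Kψ]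
    [AddCommGroup KΨ] [Module ℂ KΨ] [Module Bᵐᵒᵖ KΨ] [UniformSpace KΨ] [HilbertProModule B KΨ]
    (hE : IsFullModule A E)
    (φ ψ : A →ₗ[ℂ] B) (Φ Ψ : E → F) (hΦ : IsCPMap φ Φ) (hΨ : IsCPMap ψ Ψ)
    (η : D) (S : StinespringConstruction φ Φ η Kφ KΦ) (T : StinespringConstruction ψ Ψ η Kψ KΨ) :
    List.TFAE [
      CPEquiv B Φ Ψ,
      ∃ (U₁ : AdjOp B Kφ Kψ) (U₂ : AdjOp B KΦ KΨ) (V : AdjOp B F F),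
        U₁.IsUnitary ∧ U₂.IsUnitary ∧ IsLinkingIsometry S.W T.W V ∧ (∀ x : E, Φ x = V (Ψ x)) ∧
          StinespringRelated S T U₁ U₂ V,
      ∃ (U₁ : AdjOp B Kφ Kψ) (U₂ : AdjOp B KΦ KΨ) (V : AdjOp B F F),
        U₁.IsUnitary ∧ U₂.IsUnitary ∧ IsLinkingIsometry S.W T.W V ∧
          StinespringRelated S T U₁ U₂ V] := by
  tfae_have 2 → 3 := fun ⟨U₁, U₂, V, h₁, h₂, hV, _, h⟩ => ⟨U₁, U₂, V, h₁, h₂, hV, h⟩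
  tfae_have 3 → 1 := fun ⟨_, _, _, _, h₂, _, h⟩ => h.cpEquiv h₂
  tfae_have 1 → 2 := by
    intro h
    obtain rfl := h.linearMap_eq hE hΦ hΨ
    obtain ⟨U₁, U₂, hU₁, hU₂, hd, hmod⟩ := S.exists_unitaries T
    obtain ⟨V, hV, hadj, hlink⟩ := AdjOp.exists_linking S.coisometry T.coisometry hU₂
    refine ⟨U₁, U₂, V, hU₁, hU₂, hlink, fun x => ?_, hd, hmod, fun f => ?_⟩
    -- `V Ψ(x) = W_Φ* U₂* (W_Ψ W_Ψ*) π_Ψ(x) V_ψ η = W_Φ* U₂* U₂ π_Φ(x) V_φ η = Φ(x)`.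
    · rw [hV, T.modMap_eq, T.coisometry, hd, ← hmod, hU₂.1, S.modMap_eq]
    · rw [hadj, T.coisometry, hU₂.1]
  tfae_finish
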